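/- Let $\mathcal L:\mathbb R^d\to[0,\infty)$ be differentiable and $L$-Lipschitz-smooth with $L>0$, i.e. $\mathcal L(\theta')\le\mathcal L(\theta)+\langle\nabla\mathcal L(\theta),\theta'-\theta\rangle+\frac L2\|\theta-\theta'\|^2$ for all $\theta,\theta'\in\mathbb R^d$. For each $\theta$ let $\mathcal D_{\mathcal I}(\theta)$ (true gradient law) and $\mathcal D_{\mathcal O}(\theta)$ (arbitrary outlier law) be probability measures on $\mathbb R^d$ depending measurably on $\theta$. For $\widetilde G(\theta)\sim\mathcal D_{\mathcal I}(\theta)$ put $\varepsilon_\theta=\widetilde G(\theta)-\nabla\mathcal L(\theta)$, and assume: (i) for every $\theta$, $\mathbb E[\varepsilon_\theta]=0$, and $\varepsilon_\theta$ has law $\delta\nu_{\theta,1}+(1-\delta)\nu_{\theta,2}$ with $\delta\in(0,1]$ and probability measures $\nu_{\theta,1},\nu_{\theta,2}$, where $\nu_{\theta,1}$ has a Lebesgue density $h_\theta$ with $\inf_{\|\omega\|\le R}h_\theta(\omega)>\varkappa(R)>0$ for all $R>0$; $\delta$ and the function $\varkappa$ do not depend on $\theta$; (ii) there are $q>1$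 and $B_q>0$ with $\mathbb E[\|\varepsilon_\theta\|^q]^{1/q}\le B_q$ for all $\theta$. Let $0\le\eta<1/2$, $p=1-\eta$ and $\beta>0$. Quantile-clipped SGD on $\eta$-corrupted gradients is the Markov chain on $\mathbb R^d$ with transition kernel $P_{\beta,p}$ given by $$\theta_{t+1}=\theta_t-\alpha_{\theta_t}\beta\,G(\theta_t),\qquad \alpha_{\theta}=\min\Big(1,\frac{\tau_{\theta}}{\|G(\theta)\|}\Big),$$ where, given $\theta_t=\theta$, the sample $G(\theta)$ has law $\eta\,\mathcal D_{\mathcal O}(\theta)+(1-\eta)\,\mathcal D_{\mathcal I}(\theta)$, and $\tau_\theta=\inf\{t:\mathbb P(\|\widetilde G(\theta)\|\le t)\ge p\}$ is the $p$-quantile of $\|\widetilde G(\theta)\|$. Assume that $\frac34p(1-\eta)>L\beta+\eta$, that $\beta\le\eta^2/L$, and that the set $$\Big\{\theta:\tfrac12\|\nabla\mathcal L(\theta)\|^2\le\frac{B_q^2\big((1-p)^{-2/q}(L\beta+2\eta^2)+2\eta^{2-2/q}\big)}{p(1-\eta)\big(3p(1-\eta)/4-L\beta-\eta\big)}\Big\}$$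 is bounded. Then, for every stationary law of the chain, that is, every probability measure $\pi$ on $\mathbb R^d$ with $\pi P_{\beta,p}=\pi$, and for $\theta\sim\pi$, the variable $\|\nabla\mathcal L(\theta)\|^2$ is integrable and $$\mathbb E\|\nabla\mathcal L(\theta)\|^2\le\frac{5\,\eta^{2-2/q}B_q^2}{p(1-\eta)\big(3p(1-\eta)/4-L\beta-\eta\big)}.$$ In particular this is an $\mathcal O(\eta^{1-1/q})$ bound on the gradient, with absolute constants: if $\eta\le 1/10$, then $\big(\mathbb E\|\nabla\mathcal L(\theta)\|^2\big)^{1/2}\le 4\,B_q\,\eta^{1-1/q}$. -/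

import Mathlib

open MeasureTheory ProbabilityTheory Set
open scoped ENNReal

namespace QCSGD

noncomputable section

/-- Lipschitz smoothness with constant `L`: `f` is differentiable and lies below the
quadratic upper model with curvature `L` built from its gradient at every point. -/
def LipschitzSmooth {d : ℕ} (f : EuclideanSpace ℝ (Fin d) → ℝ) (L : ℝ) : Prop :=
  Differentiable ℝ f ∧
    ∀ θ θ' : EuclideanSpace ℝ (Fin d),
      f θ' ≤ f θ + inner ℝ (gradient f θ) (θ' - θ) + L / 2 * ‖θ - θ'‖ ^ 2

/-- Noise law at `θ`: the law of `ε = G - ∇f(θ)`, where `G` follows the law `DI θ` of an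
uncorrupted gradient sample at `θ`. -/
def noiseLaw {d : ℕ} (f : EuclideanSpace ℝ (Fin d) → ℝ)
    (DI : Kernel (EuclideanSpace ℝ (Fin d)) (EuclideanSpace ℝ (Fin d)))
    (θ : EuclideanSpace ℝ (Fin d)) : Measure (EuclideanSpace ℝ (Fin d)) :=
  (DI θ).map (fun g => g - gradient f θ)

/-- The uncorrupted gradient samples are unbiased and diffuse: the noise is integrable and
centered, and its law is a mixture `δ ν₁ + (1 - δ) ν₂` of probability measures, `δ > 0`, where
`ν₁` has a Lebesgue density which is bounded below on each centered ball of radius `R` by a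
positive constant `ϰ R`; `δ` and `ϰ` do not depend on `θ`. -/
def UnbiasedDiffuse {d : ℕ} (f : EuclideanSpace ℝ (Fin d) → ℝ)
    (DI : Kernel (EuclideanSpace ℝ (Fin d)) (EuclideanSpace ℝ (Fin d))) : Prop :=
  (∀ θ, Integrable (fun ε => ε) (noiseLaw f DI θ) ∧ ∫ ε, ε ∂(noiseLaw f DI θ) = 0) ∧
    ∃ (δ : ℝ) (ϰ : ℝ → ℝ), 0 < δ ∧ δ ≤ 1 ∧ (∀ R, 0 < R → 0 < ϰ R) ∧
      ∀ θ, ∃ (ν₁ ν₂ : Measure (EuclideanSpace ℝ (Fin d)))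
          (h : EuclideanSpace ℝ (Fin d) → ℝ≥0∞),
        IsProbabilityMeasure ν₁ ∧ IsProbabilityMeasure ν₂ ∧
        noiseLaw f DI θ = ENNReal.ofReal δ • ν₁ + ENNReal.ofReal (1 - δ) • ν₂ ∧
        Measurable h ∧ ν₁ = volume.withDensity h ∧
        ∀ R, 0 < R → ENNReal.ofReal (ϰ R) < ⨅ ω ∈ Metric.closedBall 0 R, h ω

/-- Uniform moment bound `E[‖ε_θ‖^q]^(1/q) ≤ B` for all `θ` (in particular the `q`-th moment is
finite). -/
def UniformMomentBound {d : ℕ} (f : EuclideanSpace ℝ (Fin d) → ℝ)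
    (DI : Kernel (EuclideanSpace ℝ (Fin d)) (EuclideanSpace ℝ (Fin d))) (q B : ℝ) : Prop :=
  ∀ θ, (∫⁻ ε, ENNReal.ofReal (‖ε‖ ^ q) ∂(noiseLaw f DI θ)) ^ (1 / q) ≤ ENNReal.ofReal B

/-- The `p`-quantile `Q_p = inf {t | P(X ≤ t) ≥ p}` of a real random variable with law `μ`. -/
def quantile (p : ℝ) (μ : Measure ℝ) : ℝ :=
  sInf {t : ℝ | ENNReal.ofReal p ≤ μ (Iic t)}

/-- Clipping threshold `τ_θ`: the `p`-quantile of the norm of an uncorrupted gradient sample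
at `θ`. -/
def threshold {d : ℕ} (DI : Kernel (EuclideanSpace ℝ (Fin d)) (EuclideanSpace ℝ (Fin d)))
    (p : ℝ) (θ : EuclideanSpace ℝ (Fin d)) : ℝ :=
  quantile p ((DI θ).map (fun g => ‖g‖))

/-- One iteration `θ - α β g` with clipping factor `α = min (1, τ_θ / ‖g‖)`, from the current
iterate `θ` and gradient sample `g`. -/
def step {d : ℕ} (DI : Kernel (EuclideanSpace ℝ (Fin d)) (EuclideanSpace ℝ (Fin d)))
    (β p : ℝ) (θ g : EuclideanSpace ℝ (Fin d)) : EuclideanSpace ℝ (Fin d) :=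
  θ - (min 1 (threshold DI p θ / ‖g‖) * β) • g

/-- Law of the gradient sample actually used at `θ`: with probability `η` it is drawn from the
outlier law `DO θ`, with probability `1 - η` from the law `DI θ` of uncorrupted samples. -/
def corruptedGradient {d : ℕ}
    (DI DO : Kernel (EuclideanSpace ℝ (Fin d)) (EuclideanSpace ℝ (Fin d))) (η : ℝ) :
    Kernel (EuclideanSpace ℝ (Fin d)) (EuclideanSpace ℝ (Fin d)) where
  toFun θ := ENNReal.ofReal η • DO θ + ENNReal.ofReal (1 - η) • DI θ
  measurable' := by
    refine Measure.measurable_of_measurable_coe _ fun s hs => ?_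
    simp only [Measure.coe_add, Measure.coe_smul, Pi.add_apply, Pi.smul_apply, smul_eq_mul]
    exact ((Kernel.measurable_coe DO hs).const_mul _).add
      ((Kernel.measurable_coe DI hs).const_mul _)

instance {d : ℕ} (DI DO : Kernel (EuclideanSpace ℝ (Fin d)) (EuclideanSpace ℝ (Fin d)))
    [IsMarkovKernel DI] [IsMarkovKernel DO] (η : ℝ) :
    IsFiniteKernel (corruptedGradient DI DO η) where
  exists_univ_le := ⟨ENNReal.ofReal η + ENNReal.ofReal (1 - η), by simp, fun θ => by
    simp [corruptedGradient]⟩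

theorem measurable_threshold {d : ℕ}
    (DI : Kernel (EuclideanSpace ℝ (Fin d)) (EuclideanSpace ℝ (Fin d))) (p : ℝ) :
    Measurable (threshold DI p) := by
  rcases le_or_gt p 0 with hp | hp
  · have h : threshold DI p = fun _ => 0 := by
      funext θ
      simp [threshold, quantile, ENNReal.ofReal_of_nonpos hp]
    rw [h]
    exact measurable_const
  · have hF : ∀ t : ℝ, MeasurableSet
        {θ | ENNReal.ofReal p ≤ (DI θ).map (fun g => ‖g‖) (Iic t)} := fun t => by
      simp only [Measure.map_apply measurable_norm measurableSet_Iic]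
      exact measurableSet_le measurable_const
        (Kernel.measurable_coe DI (measurable_norm measurableSet_Iic))
    have hup : ∀ θ, ∀ s t : ℝ, s ≤ t →
        ENNReal.ofReal p ≤ (DI θ).map (fun g => ‖g‖) (Iic s) →
        ENNReal.ofReal p ≤ (DI θ).map (fun g => ‖g‖) (Iic t) := fun θ s t hst h =>
      h.trans (measure_mono (Iic_subset_Iic.2 hst))
    have hbdd : ∀ θ, BddBelow
        {t : ℝ | ENNReal.ofReal p ≤ (DI θ).map (fun g => ‖g‖) (Iic t)} := fun θ => by
      refine ⟨0, fun t ht => ?_⟩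
      by_contra hneg
      push Not at hneg
      have he : (fun g : EuclideanSpace ℝ (Fin d) => ‖g‖) ⁻¹' Iic t = ∅ := by
        ext g
        simpa using lt_of_lt_of_le hneg (norm_nonneg g)
      simp only [mem_ofPred_eq, Measure.map_apply measurable_norm measurableSet_Iic, he,
        measure_empty, nonpos_iff_eq_zero, ENNReal.ofReal_eq_zero] at ht
      linarith
    refine measurable_of_Iio fun a => ?_
    have heq : threshold DI p ⁻¹' Iio a =
        (⋃ r : ℚ, {θ | (r : ℝ) < a ∧
          ENNReal.ofReal p ≤ (DI θ).map (fun g => ‖g‖) (Iic (r : ℝ))}) ∪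
        ((⋂ n : ℕ, {θ | ENNReal.ofReal p ≤ (DI θ).map (fun g => ‖g‖) (Iic (n : ℝ))}ᶜ) ∩
          {_θ | 0 < a}) := by
      ext θ
      simp only [mem_preimage, mem_Iio, threshold, quantile, mem_union, mem_iUnion,
        mem_ofPred_eq, mem_inter_iff, mem_iInter, mem_compl_iff]
      rcases eq_empty_or_nonempty
        {t : ℝ | ENNReal.ofReal p ≤ (DI θ).map (fun g => ‖g‖) (Iic t)} with he | hne
      · have hno : ∀ t : ℝ, ¬ ENNReal.ofReal p ≤ (DI θ).map (fun g => ‖g‖) (Iic t) :=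
          fun t ht => by
            have : t ∈ (∅ : Set ℝ) := he ▸ ht
            exact this
        rw [he, Real.sInf_empty]
        exact ⟨fun h => Or.inr ⟨fun n => hno n, h⟩, fun h => h.elim
          (fun ⟨r, _, hr⟩ => absurd hr (hno r)) (fun h => h.2)⟩
      · constructor
        · intro h
          obtain ⟨t, ht, hta⟩ := (csInf_lt_iff (hbdd θ) hne).1 h
          obtain ⟨r, htr, hra⟩ := exists_rat_btwn hta
          exact Or.inl ⟨r, hra, hup θ t r htr.le ht⟩
        · rintro (⟨r, hra, hr⟩ | ⟨hn, _⟩)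
          · exact (csInf_lt_iff (hbdd θ) hne).2 ⟨r, hr, hra⟩
          · obtain ⟨t, ht⟩ := hne
            obtain ⟨n, hn'⟩ := exists_nat_ge t
            exact absurd (hup θ t n hn' ht) (hn n)
    rw [heq]
    refine MeasurableSet.union (MeasurableSet.iUnion fun r : ℚ => ?_)
      ((MeasurableSet.iInter fun n : ℕ => (hF (n : ℝ)).compl).inter (MeasurableSet.const _))
    exact (MeasurableSet.const _).inter (hF r)

theorem measurable_step {d : ℕ}
    (DI : Kernel (EuclideanSpace ℝ (Fin d)) (EuclideanSpace ℝ (Fin d))) (β p : ℝ) :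
    Measurable (fun x : EuclideanSpace ℝ (Fin d) × EuclideanSpace ℝ (Fin d) =>
      step DI β p x.1 x.2) := by
  unfold step
  have h : Measurable (fun x : EuclideanSpace ℝ (Fin d) × EuclideanSpace ℝ (Fin d) =>
      threshold DI p x.1) := (measurable_threshold DI p).comp measurable_fst
  exact measurable_fst.sub (((measurable_const.min
    (h.div measurable_snd.norm)).mul_const β).smul measurable_snd)

/-- Markov transition kernel `P_{β,p}` of quantile-clipped SGD on `η`-corrupted gradients: the
law of the next iterate given the current iterate `θ`. -/
def transitionKernel {d : ℕ}
    (DI DO : Kernel (EuclideanSpace ℝ (Fin d)) (EuclideanSpace ℝ (Fin d)))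
    [IsMarkovKernel DI] [IsMarkovKernel DO] (η β p : ℝ) :
    Kernel (EuclideanSpace ℝ (Fin d)) (EuclideanSpace ℝ (Fin d)) where
  toFun θ := (corruptedGradient DI DO η θ).map (fun g => step DI β p θ g)
  measurable' := by
    refine Measure.measurable_of_measurable_coe _ fun s hs => ?_
    have h : ∀ θ, (corruptedGradient DI DO η θ).map (fun g => step DI β p θ g) s =
        corruptedGradient DI DO η θ (Prod.mk θ ⁻¹'
          ((fun x : EuclideanSpace ℝ (Fin d) × EuclideanSpace ℝ (Fin d) =>
            step DI β p x.1 x.2) ⁻¹' s)) := fun θ =>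
      Measure.map_apply ((measurable_step DI β p).comp measurable_prodMk_left) hs
    simp only [h]
    exact Kernel.measurable_kernel_prodMk_left (measurable_step DI β p hs)

/-- The sublevel set of the gradient norm whose boundedness is the identifiability condition for
ergodicity. -/
def lowGradientSet {d : ℕ} (f : EuclideanSpace ℝ (Fin d) → ℝ) (L q B η β p : ℝ) :
    Set (EuclideanSpace ℝ (Fin d)) :=
  {θ | 1 / 2 * ‖gradient f θ‖ ^ 2 ≤
    B ^ 2 * ((1 - p) ^ (-(2 / q)) * (L * β + 2 * η ^ 2) + 2 * η ^ (2 - 2 / q)) /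
      (p * (1 - η) * (3 * p * (1 - η) / 4 - L * β - η))}

end

end QCSGD

/-! The loss `f` is a Lyapunov function. Write x = ‖∇f(θ)‖, b₀ = B η^(-1/q), b = B η^(1-1/q) = η b₀.
Smoothness bounds the value of `f` after one step by f(θ) - β α⟨∇f, G⟩ + (L/2) β² τ², since a
clipped sample has norm at most τ.

Markov's inequality puts an uncorrupted sample within b₀ of ∇f with probability at least 1 - η = p,
hence τ ≤ x + b₀. An outlier costs at most β x τ (`lintegral_step_outlier_le`). An inlier gains at
least β(p x² - x b) on average (`lintegral_step_inlier_le`): the centered noise integrates to zero,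
and the clipping bias lives on an event of probability at most η, where Hölder's inequality gives b.
Weighting the two cases by η and 1 - η and absorbing the cross terms (`drift_arith`) gives the drift
inequality P f + β κ x² ≤ f + 5 β b² / (p(1 - η)), with κ = 3p(1 - η)/4 - Lβ - η.

Integrating it against π would cancel `f`, but `f` need not be π-integrable; `lintegral_le_of_drift`
gets around this by truncation. -/

namespace QCSGD

open Filter Topology

/-! ### Drift inequalities and invariant measures. -/

section Invariant

/-- A Foster–Lyapunov drift inequality `K V + φ ≤ V + C` with a finite function `V` bounds the mean
of `φ` under every invariant probability measure, even if `V` itself is not integrable. -/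
theorem lintegral_le_of_drift {α : Type*} [MeasurableSpace α] {K : Kernel α α} {π : Measure α}
    [IsProbabilityMeasure π] (hK : ∀ x, K x univ ≤ 1) (hπ : K.Invariant π)
    {V φ : α → ℝ≥0∞} {C : ℝ≥0∞} (hV : Measurable V) (hV_top : ∀ x, V x ≠ ∞)
    (hφ : Measurable φ) (h : ∀ x, ∫⁻ y, V y ∂(K x) + φ x ≤ V x + C) :
    ∫⁻ x, φ x ∂π ≤ C := by
  have htrunc : ∀ n : ℕ, ∫⁻ x, {x | V x ≤ n}.indicator φ x ∂π ≤ C := by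
    intro n
    have hVn : Measurable fun x => min (V x) (n : ℝ≥0∞) := hV.min measurable_const
    have hfin : ∫⁻ x, min (V x) (n : ℝ≥0∞) ∂π ≠ ∞ := by
      refine ne_top_of_le_ne_top (ENNReal.natCast_ne_top n) ?_
      calc ∫⁻ x, min (V x) (n : ℝ≥0∞) ∂π ≤ ∫⁻ _, (n : ℝ≥0∞) ∂π :=
            lintegral_mono fun x => min_le_right _ _
        _ = n := by simp
    -- The drift survives truncation at level n: where V > n, the truncation already has its maximal
    -- value n, which averaging cannot increase.
    have hpt : ∀ x, ∫⁻ y, min (V y) (n : ℝ≥0∞) ∂(K x) + {x | V x ≤ n}.indicator φ x ≤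
        min (V x) n + C := by
      intro x
      by_cases hx : V x ≤ n
      · rw [indicator_of_mem (by exact hx), min_eq_left hx]
        exact (add_le_add_left (lintegral_mono fun y => min_le_left _ _) _).trans (h x)
      · rw [indicator_of_notMem (by exact hx), min_eq_right (not_le.1 hx).le, add_zero]
        calc ∫⁻ y, min (V y) (n : ℝ≥0∞) ∂(K x) ≤ ∫⁻ _, (n : ℝ≥0∞) ∂(K x) :=
              lintegral_mono fun y => min_le_right _ _
          _ = n * K x univ := by simp
          _ ≤ n * 1 := by gcongr; exact hK x
          _ ≤ n + C := by simp
    -- By invariance both sides contain the same integral of the truncation; it is finite, so it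
    -- cancels.
    have hint := lintegral_mono (μ := π) hpt
    rw [lintegral_add_right _ (hφ.indicator (measurableSet_le hV measurable_const)),
      lintegral_add_right _ measurable_const, ← Measure.lintegral_bind K.measurable.aemeasurable
      hVn.aemeasurable, hπ.def] at hint
    simpa using (ENNReal.add_le_add_iff_left hfin).1 hint
  have hmono : Monotone fun (n : ℕ) x => {x | V x ≤ n}.indicator φ x := by
    intro m n hmn x
    refine indicator_le_indicator_of_subset (fun y hy => ?_) (fun _ => zero_le) x
    exact le_trans (show V y ≤ m from hy) (by exact_mod_cast hmn)
  have hsup : φ = fun x => ⨆ n : ℕ, {x | V x ≤ n}.indicator φ x := by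
    funext x
    refine le_antisymm ?_ (iSup_le fun n => indicator_le_self _ _ x)
    -- Finiteness of V makes its sublevel sets exhaust the space, so monotone convergence applies.
    obtain ⟨n, hn⟩ := ENNReal.exists_nat_gt (hV_top x)
    refine le_iSup_of_le n ?_
    rw [indicator_of_mem (show x ∈ {x | V x ≤ n} from hn.le)]
  rw [hsup, lintegral_iSup (fun n => hφ.indicator (measurableSet_le hV measurable_const)) hmono]
  exact iSup_le htrunc

end Invariant

/-! ### Quantiles of nonnegative variables. -/

section Quantile

theorem nonneg_of_le_measure_Iic {p t : ℝ} (hp : 0 < p) {μ : Measure ℝ} (hμ : μ (Iio 0) = 0)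
    (ht : ENNReal.ofReal p ≤ μ (Iic t)) : 0 ≤ t := by
  by_contra! hneg
  have h0 : μ (Iic t) = 0 := measure_mono_null (fun s hs => lt_of_le_of_lt hs hneg) hμ
  rw [h0, nonpos_iff_eq_zero, ENNReal.ofReal_eq_zero] at ht
  linarith

theorem quantile_nonneg {p : ℝ} (hp : 0 < p) {μ : Measure ℝ} (hμ : μ (Iio 0) = 0) :
    0 ≤ quantile p μ :=
  Real.sInf_nonneg fun _ ht => nonneg_of_le_measure_Iic hp hμ ht

theorem quantile_le {p t : ℝ} (hp : 0 < p) {μ : Measure ℝ} (hμ : μ (Iio 0) = 0)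
    (ht : ENNReal.ofReal p ≤ μ (Iic t)) : quantile p μ ≤ t :=
  csInf_le ⟨0, fun _ hs => nonneg_of_le_measure_Iic hp hμ hs⟩ ht

/-- The infimum is attained because a distribution function is right-continuous. The witness `t`
excludes the empty set, whose `sInf` is 0 by convention. -/
theorem le_measureReal_Iic_quantile {p t : ℝ} {μ : Measure ℝ} [IsProbabilityMeasure μ]
    (ht : ENNReal.ofReal p ≤ μ (Iic t)) :
    p ≤ μ.real (Iic (quantile p μ)) := by
  rw [← cdf_eq_real]
  have hlim : Tendsto (cdf μ) (𝓝[>] quantile p μ) (𝓝 (cdf μ (quantile p μ))) :=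
    ((cdf μ).right_continuous _).mono Ioi_subset_Ici_self
  refine ge_of_tendsto hlim ?_
  filter_upwards [self_mem_nhdsWithin] with s hs
  obtain ⟨u, hu, hus⟩ := exists_lt_of_csInf_lt ⟨t, ht⟩ (show quantile p μ < s from hs)
  have hps : ENNReal.ofReal p ≤ μ (Iic s) := le_trans hu (measure_mono (Iic_subset_Iic.2 hus.le))
  rw [cdf_eq_real]
  exact (ENNReal.ofReal_le_iff_le_toReal (measure_ne_top _ _)).1 hps

end Quantile

/-! ### Tail and truncated-mean bounds from a q-th moment. -/

section Moments

variable {Ω : Type*} [MeasurableSpace Ω] {μ : Measure Ω} {X : Ω → ℝ} {q B : ℝ}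

theorem lintegral_rpow_le_of_moment (hq : 1 < q) (hB : 0 < B)
    (hm : (∫⁻ ω, ENNReal.ofReal (X ω ^ q) ∂μ) ^ (1 / q) ≤ ENNReal.ofReal B) :
    ∫⁻ ω, ENNReal.ofReal (X ω ^ q) ∂μ ≤ ENNReal.ofReal (B ^ q) := by
  rw [one_div, ENNReal.rpow_inv_le_iff (by linarith), ENNReal.ofReal_rpow_of_pos hB] at hm
  exact hm

/-- Markov's inequality for the `q`-th moment, at the level where it gives probability `η`. -/
theorem measure_gt_le_of_moment (hX : Measurable X) (hq : 1 < q) (hB : 0 < B)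
    (hm : (∫⁻ ω, ENNReal.ofReal (X ω ^ q) ∂μ) ^ (1 / q) ≤ ENNReal.ofReal B)
    {η : ℝ} (hη : 0 < η) :
    μ {ω | B * η ^ (-(1 / q)) < X ω} ≤ ENNReal.ofReal η := by
  have hlevel : (B * η ^ (-(1 / q))) ^ q = B ^ q / η := by
    rw [Real.mul_rpow hB.le (by positivity), ← Real.rpow_mul hη.le,
      show -(1 / q) * q = -1 by field_simp, Real.rpow_neg_one, div_eq_mul_inv]
  have hpos : 0 < B ^ q / η := by positivity
  have hmarkov := meas_ge_le_lintegral_div (μ := μ) (f := fun ω => ENNReal.ofReal (X ω ^ q))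
    (by fun_prop) (ε := ENNReal.ofReal (B ^ q / η))
    (by simpa using hpos) ENNReal.ofReal_ne_top
  calc μ {ω | B * η ^ (-(1 / q)) < X ω}
      ≤ μ {ω | ENNReal.ofReal (B ^ q / η) ≤ ENNReal.ofReal (X ω ^ q)} := by
        refine measure_mono fun ω hω => ENNReal.ofReal_le_ofReal ?_
        rw [← hlevel]
        exact Real.rpow_le_rpow (by positivity) (le_of_lt hω) (by linarith)
    _ ≤ ENNReal.ofReal (B ^ q) / ENNReal.ofReal (B ^ q / η) :=
        hmarkov.trans (ENNReal.div_le_div_right (lintegral_rpow_le_of_moment hq hB hm) _)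
    _ = ENNReal.ofReal η := by
        rw [← ENNReal.ofReal_div_of_pos hpos]
        congr 1
        have : 0 < B ^ q := by positivity
        field_simp

/-- Hölder's inequality on an event of probability at most `η`. -/
theorem setIntegral_le_of_moment (hX : Measurable X) (hX₀ : ∀ ω, 0 ≤ X ω)
    (hq : 1 < q) (hB : 0 < B)
    (hm : (∫⁻ ω, ENNReal.ofReal (X ω ^ q) ∂μ) ^ (1 / q) ≤ ENNReal.ofReal B)
    {η : ℝ} (hη : 0 < η) {s : Set Ω} (hsη : μ s ≤ ENNReal.ofReal η) :
    ∫ ω in s, X ω ∂μ ≤ B * η ^ (1 - 1 / q) := by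
  have hq₀ : 0 < q := by linarith
  have hconj : q.HolderConjugate (Real.conjExponent q) := Real.HolderConjugate.conjExponent hq
  have hexp : 1 / Real.conjExponent q = 1 - 1 / q := by
    rw [one_div, one_div, ← hconj.one_sub_inv]
  have hexp₀ : 0 < 1 - 1 / q := by rw [← hexp]; exact one_div_pos.2 hconj.symm.pos
  have hle : ∫⁻ ω in s, ENNReal.ofReal (X ω) ∂μ ≤ ENNReal.ofReal (B * η ^ (1 - 1 / q)) := by
    calc ∫⁻ ω in s, ENNReal.ofReal (X ω) ∂μ
        = ∫⁻ ω in s, ((fun ω => ENNReal.ofReal (X ω)) * fun _ => (1 : ℝ≥0∞) : Ω → ℝ≥0∞) ω ∂μ := by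
          simp
      _ ≤ (∫⁻ ω in s, ENNReal.ofReal (X ω) ^ q ∂μ) ^ (1 / q) *
          (∫⁻ _ in s, (1 : ℝ≥0∞) ^ Real.conjExponent q ∂μ) ^ (1 / Real.conjExponent q) :=
          ENNReal.lintegral_mul_le_Lp_mul_Lq _ hconj hX.ennreal_ofReal.aemeasurable
            aemeasurable_const
      _ ≤ ENNReal.ofReal B * ENNReal.ofReal η ^ (1 - 1 / q) := by
          rw [hexp]
          gcongr
          · refine le_trans ?_ hm
            refine ENNReal.rpow_le_rpow ?_ (by positivity)
            refine (setLIntegral_le_lintegral _ _).trans (lintegral_mono fun ω => ?_)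
            rw [ENNReal.ofReal_rpow_of_nonneg (hX₀ ω) hq₀.le]
          · simpa using hsη
      _ = ENNReal.ofReal (B * η ^ (1 - 1 / q)) := by
          rw [ENNReal.ofReal_rpow_of_pos hη, ← ENNReal.ofReal_mul hB.le]
  rw [integral_eq_lintegral_of_nonneg_ae (ae_of_all _ hX₀) hX.aestronglyMeasurable]
  exact ENNReal.toReal_le_of_le_ofReal (by positivity) hle

end Moments

/-! ### Descent of the loss in one clipped step. -/

section Descent

variable {d : ℕ} {f : EuclideanSpace ℝ (Fin d) → ℝ}
  {DI DO : Kernel (EuclideanSpace ℝ (Fin d)) (EuclideanSpace ℝ (Fin d))} {L q B η β p : ℝ}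

theorem clip_mul_norm_le {τ r : ℝ} (hτ : 0 ≤ τ) (hr : 0 ≤ r) : min 1 (τ / r) * r ≤ τ := by
  rcases hr.eq_or_lt with rfl | hr
  · simpa using hτ
  · calc min 1 (τ / r) * r ≤ τ / r * r := by gcongr; exact min_le_right _ _
      _ = τ := by field_simp

theorem clip_nonneg {τ r : ℝ} (hτ : 0 ≤ τ) (hr : 0 ≤ r) : 0 ≤ min 1 (τ / r) :=
  le_min zero_le_one (div_nonneg hτ hr)

theorem LipschitzSmooth.step_le (hf : LipschitzSmooth f L) (hL : 0 < L)
    (θ y : EuclideanSpace ℝ (Fin d)) (hτ : 0 ≤ threshold DI p θ) :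
    f (step DI β p θ y) ≤ f θ - β * (min 1 (threshold DI p θ / ‖y‖) * inner ℝ (gradient f θ) y) +
      L / 2 * β ^ 2 * threshold DI p θ ^ 2 := by
  have h := hf.2 θ (step DI β p θ y)
  set c := min 1 (threshold DI p θ / ‖y‖) with hc
  have h1 : step DI β p θ y - θ = -((c * β) • y) := by simp [step, hc]
  have h2 : θ - step DI β p θ y = (c * β) • y := by simp [step, hc]
  rw [h1, h2, inner_neg_right, real_inner_smul_right, norm_smul, mul_pow, Real.norm_eq_abs,
    sq_abs] at h
  have h3 : (c * ‖y‖) ^ 2 ≤ threshold DI p θ ^ 2 :=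
    pow_le_pow_left₀ (mul_nonneg (clip_nonneg hτ (norm_nonneg y)) (norm_nonneg y))
      (clip_mul_norm_le hτ (norm_nonneg y)) 2
  have h4 : L / 2 * β ^ 2 * (c * ‖y‖) ^ 2 ≤ L / 2 * β ^ 2 * threshold DI p θ ^ 2 := by gcongr
  linarith

/-- Worst-case inner product of the gradient with a clipped sample. -/
theorem neg_le_clip_mul_inner {E : Type*} [NormedAddCommGroup E] [InnerProductSpace ℝ E]
    {τ : ℝ} (hτ : 0 ≤ τ) (g y : E) : -(‖g‖ * τ) ≤ min 1 (τ / ‖y‖) * inner ℝ g y := by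
  have h1 : -(‖g‖ * ‖y‖) ≤ inner ℝ g y := (abs_le.1 (abs_real_inner_le_norm g y)).1
  have h2 := clip_nonneg hτ (norm_nonneg y)
  have h3 := clip_mul_norm_le hτ (norm_nonneg y)
  calc -(‖g‖ * τ) ≤ -(‖g‖ * (min 1 (τ / ‖y‖) * ‖y‖)) := by gcongr
    _ = min 1 (τ / ‖y‖) * -(‖g‖ * ‖y‖) := by ring
    _ ≤ _ := by gcongr

/-- Inner product of the gradient with a clipped sample, compared with the unclipped noise. -/
theorem le_clip_mul_inner {E : Type*} [NormedAddCommGroup E] [InnerProductSpace ℝ E]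
    {τ : ℝ} (hτ : 0 ≤ τ) (g y : E) :
    {y : E | ‖y‖ ≤ τ}.indicator (fun _ => ‖g‖ ^ 2) y + inner ℝ g (y - g) -
      {y : E | ‖y‖ ≤ τ}ᶜ.indicator (fun y => ‖g‖ * ‖y - g‖) y ≤
      min 1 (τ / ‖y‖) * inner ℝ g y := by
  have hgg : inner ℝ g (y - g) = inner ℝ g y - ‖g‖ ^ 2 := by
    rw [inner_sub_right, real_inner_self_eq_norm_sq]
  by_cases hy : ‖y‖ ≤ τ
  · rw [indicator_of_mem (by exact hy), indicator_of_notMem (by simpa using hy), hgg]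
    -- At y = 0 the clipping factor is 0 rather than 1, since division by zero gives 0; the inner
    -- product vanishes anyway.
    rcases eq_or_ne y 0 with rfl | hy₀
    · simp
    · rw [min_eq_left ((one_le_div (norm_pos_iff.2 hy₀)).2 hy)]
      linarith
  · rw [indicator_of_notMem (by exact hy), indicator_of_mem (by exact hy)]
    have h2 := clip_nonneg hτ (norm_nonneg y)
    have h1 : min 1 (τ / ‖y‖) ≤ 1 := min_le_left _ _
    have h4 : inner ℝ g (y - g) ≤ ‖g‖ * ‖y - g‖ := real_inner_le_norm g (y - g)
    set c := min 1 (τ / ‖y‖)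
    have h5 : inner ℝ g y = ‖g‖ ^ 2 + inner ℝ g (y - g) := by rw [hgg]; ring
    rw [h5]
    -- The noise is kept with weight 1 instead of c so that its mean vanishes; Cauchy–Schwarz pays
    -- for the difference.
    have h6 : (1 - c) * inner ℝ g (y - g) ≤ (1 - c) * (‖g‖ * ‖y - g‖) := by
      gcongr
    have h7 : 0 ≤ c * (‖g‖ * ‖y - g‖) := by positivity
    have h8 : 0 ≤ c * ‖g‖ ^ 2 := by positivity
    linarith

theorem map_norm_Iio_zero (μ : Measure (EuclideanSpace ℝ (Fin d))) :
    μ.map (fun g => ‖g‖) (Iio 0) = 0 := by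
  rw [Measure.map_apply measurable_norm measurableSet_Iio]
  convert measure_empty (μ := μ)
  ext g
  simp

theorem UniformMomentBound.moment_le (hm : UniformMomentBound f DI q B)
    (θ : EuclideanSpace ℝ (Fin d)) :
    (∫⁻ y, ENNReal.ofReal (‖y - gradient f θ‖ ^ q) ∂(DI θ)) ^ (1 / q) ≤ ENNReal.ofReal B := by
  have h := hm θ
  rwa [noiseLaw, lintegral_map (by fun_prop) (by fun_prop)] at h

theorem measurable_step_right (DI : Kernel (EuclideanSpace ℝ (Fin d)) (EuclideanSpace ℝ (Fin d)))
    (β p : ℝ) (θ : EuclideanSpace ℝ (Fin d)) : Measurable fun g => step DI β p θ g :=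
  (measurable_step DI β p).comp measurable_prodMk_left

/-- Nothing is known about the outlier law, so the worst-case bound for a clipped sample is used
pointwise. -/
theorem lintegral_step_outlier_le [IsMarkovKernel DO] (hL : 0 < L)
    (hf : LipschitzSmooth f L) (hβ : 0 < β) (θ : EuclideanSpace ℝ (Fin d))
    (hτ : 0 ≤ threshold DI p θ) :
    ∫⁻ y, ENNReal.ofReal (f (step DI β p θ y)) ∂(DO θ) ≤
      ENNReal.ofReal (f θ + β * (‖gradient f θ‖ * threshold DI p θ) +
        L / 2 * β ^ 2 * threshold DI p θ ^ 2) := by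
  calc _ ≤ ∫⁻ _, ENNReal.ofReal (f θ + β * (‖gradient f θ‖ * threshold DI p θ) +
        L / 2 * β ^ 2 * threshold DI p θ ^ 2) ∂(DO θ) := by
        refine lintegral_mono fun y => ENNReal.ofReal_le_ofReal ?_
        refine (hf.step_le hL θ y hτ).trans ?_
        have := mul_le_mul_of_nonneg_left (neg_le_clip_mul_inner hτ (gradient f θ) y) hβ.le
        linarith
    _ = _ := by simp

/-- The cross terms add up to (2 - η) x b: x b from outliers and (1 - η) x b from inliers. Young's
inequality trades them for a quarter of (1 - η)² x², whence the factor 3/4, plus (2 - η)² b² / (1 -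
η)². The curvature term adds Lβx² + b², because Lβ ≤ η² turns Lβ b₀² into at most b². The constant 5
comes from (1 - η)² + (2 - η)² ≤ 5. -/
theorem drift_arith {L β η x b b₀ τ : ℝ} (hL : 0 < L) (hβ : 0 < β) (hη : 0 < η)
    (hη' : η < 1 / 2) (hLβ : L * β ≤ η ^ 2) (hx : 0 ≤ x) (hb : b = η * b₀)
    (hτ₀ : 0 ≤ τ) (hτ : τ ≤ x + b₀) :
    η * (β * (x * τ) + L / 2 * β ^ 2 * τ ^ 2) +
      (1 - η) * (-(β * ((1 - η) * x ^ 2 - x * b)) + L / 2 * β ^ 2 * τ ^ 2) +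
      β * ((3 * (1 - η) * (1 - η) / 4 - L * β - η) * x ^ 2) ≤
      β * (5 * b ^ 2 / ((1 - η) * (1 - η))) := by
  have hτ2 : τ ^ 2 ≤ 2 * x ^ 2 + 2 * b₀ ^ 2 := by nlinarith [sq_nonneg (x - b₀)]
  have hxτ : x * τ ≤ x * (x + b₀) := by gcongr
  have hs : 0 < (1 - η) * (1 - η) := by nlinarith
  have hLb : L * β * b₀ ^ 2 ≤ b ^ 2 := by
    rw [hb, mul_pow]; gcongr
  have h1 : L / 2 * β * τ ^ 2 ≤ L * β * x ^ 2 + b ^ 2 := by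
    have : L / 2 * β * τ ^ 2 ≤ L / 2 * β * (2 * x ^ 2 + 2 * b₀ ^ 2) := by gcongr
    linarith
  have h2 : η * (x * τ) ≤ η * x ^ 2 + x * b := by
    have := mul_le_mul_of_nonneg_left hxτ hη.le
    rw [hb]; linarith
  have h3 : (2 - η) * (x * b) ≤ (1 - η) * (1 - η) * x ^ 2 / 4 +
      (2 - η) ^ 2 * b ^ 2 / ((1 - η) * (1 - η)) := by
    have hsq := sq_nonneg ((1 - η) * (1 - η) * x / 2 - (2 - η) * b)
    rw [← sub_nonneg]
    have : (1 - η) * (1 - η) * x ^ 2 / 4 + (2 - η) ^ 2 * b ^ 2 / ((1 - η) * (1 - η)) -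
        (2 - η) * (x * b) =
        ((1 - η) * (1 - η) * x / 2 - (2 - η) * b) ^ 2 / ((1 - η) * (1 - η)) := by
      have : 1 - η ≠ 0 := by linarith
      field_simp
      ring
    rw [this]
    positivity
  have h4 : b ^ 2 + (2 - η) ^ 2 * b ^ 2 / ((1 - η) * (1 - η)) ≤
      5 * b ^ 2 / ((1 - η) * (1 - η)) := by
    rw [← sub_nonneg]
    have : 5 * b ^ 2 / ((1 - η) * (1 - η)) -
        (b ^ 2 + (2 - η) ^ 2 * b ^ 2 / ((1 - η) * (1 - η))) =
        (6 * η - 2 * η ^ 2) * b ^ 2 / ((1 - η) * (1 - η)) := by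
      have : 1 - η ≠ 0 := by linarith
      field_simp
      ring
    rw [this]
    have : 0 ≤ 6 * η - 2 * η ^ 2 := by nlinarith
    positivity
  have h5 : η * (x * τ) + L / 2 * β * τ ^ 2 - (1 - η) * ((1 - η) * x ^ 2 - x * b) +
      (3 * (1 - η) * (1 - η) / 4 - L * β - η) * x ^ 2 ≤ 5 * b ^ 2 / ((1 - η) * (1 - η)) := by
    linarith
  have h6 := mul_le_mul_of_nonneg_left h5 hβ.le
  linarith

variable [IsMarkovKernel DI] [IsMarkovKernel DO]

/-- Markov's inequality and the triangle inequality. This serves both to bound the threshold from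
above and to show that the quantile is attained. -/
theorem UniformMomentBound.ofReal_le_measure (hm : UniformMomentBound f DI q B)
    (hq : 1 < q) (hB : 0 < B) (hη : 0 < η) (θ : EuclideanSpace ℝ (Fin d)) :
    ENNReal.ofReal (1 - η) ≤
      (DI θ).map (fun g => ‖g‖) (Iic (‖gradient f θ‖ + B * η ^ (-(1 / q)))) := by
  rw [Measure.map_apply measurable_norm measurableSet_Iic]
  have hs : MeasurableSet {y | B * η ^ (-(1 / q)) < ‖y - gradient f θ‖} :=
    measurableSet_lt measurable_const (by fun_prop)
  have h := measure_gt_le_of_moment (μ := DI θ) (X := fun y => ‖y - gradient f θ‖)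
    (by fun_prop) hq hB (hm.moment_le θ) hη
  calc ENNReal.ofReal (1 - η) = 1 - ENNReal.ofReal η := by
        rw [ENNReal.ofReal_sub _ hη.le, ENNReal.ofReal_one]
    _ ≤ 1 - DI θ {y | B * η ^ (-(1 / q)) < ‖y - gradient f θ‖} := tsub_le_tsub_left h 1
    _ = DI θ {y | B * η ^ (-(1 / q)) < ‖y - gradient f θ‖}ᶜ := (prob_compl_eq_one_sub hs).symm
    _ ≤ _ := by
        refine measure_mono fun y hy => ?_
        simp only [mem_compl_iff, mem_ofPred_eq, not_lt] at hy
        have := norm_sub_norm_le y (gradient f θ)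
        simp only [mem_preimage, mem_Iic]
        linarith

/-- The pointwise bound `le_clip_mul_inner` is integrated. The first conjunct is recorded because
`ENNReal.ofReal` is additive only on nonnegative reals, as needed when the two cases are mixed. -/
theorem lintegral_step_inlier_le (hf_nonneg : ∀ θ, 0 ≤ f θ) (hL : 0 < L)
    (hf : LipschitzSmooth f L) (hη : 0 < η) (hη' : η < 1 / 2) (hdiffuse : UnbiasedDiffuse f DI)
    (hq : 1 < q) (hB : 0 < B) (hm : UniformMomentBound f DI q B) (hp : p = 1 - η) (hβ : 0 < β)
    (θ : EuclideanSpace ℝ (Fin d)) :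
    0 ≤ f θ - β * (p * ‖gradient f θ‖ ^ 2 -
        ‖gradient f θ‖ * (B * η ^ (1 - 1 / q))) + L / 2 * β ^ 2 * threshold DI p θ ^ 2 ∧
    ∫⁻ y, ENNReal.ofReal (f (step DI β p θ y)) ∂(DI θ) ≤
      ENNReal.ofReal (f θ - β * (p * ‖gradient f θ‖ ^ 2 -
        ‖gradient f θ‖ * (B * η ^ (1 - 1 / q))) + L / 2 * β ^ 2 * threshold DI p θ ^ 2) := by
  set g := gradient f θ with hg
  set τ := threshold DI p θ with hτ_def
  have hp₀ : 0 < p := by linarith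
  have hτ : 0 ≤ τ := quantile_nonneg hp₀ (map_norm_Iio_zero _)
  have hs : MeasurableSet {y : EuclideanSpace ℝ (Fin d) | ‖y‖ ≤ τ} :=
    measurableSet_le measurable_norm measurable_const
  have : IsProbabilityMeasure ((DI θ).map fun g => ‖g‖) :=
    Measure.isProbabilityMeasure_map (by fun_prop)
  have hps : p ≤ (DI θ).real {y | ‖y‖ ≤ τ} := by
    have h := le_measureReal_Iic_quantile
      (hp ▸ hm.ofReal_le_measure hq hB hη θ :
        ENNReal.ofReal p ≤ (DI θ).map (fun g => ‖g‖) (Iic (‖g‖ + B * η ^ (-(1 / q)))))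
    rwa [map_measureReal_apply measurable_norm measurableSet_Iic] at h
  have hsc : DI θ {y | ‖y‖ ≤ τ}ᶜ ≤ ENNReal.ofReal η := by
    rw [← ofReal_measureReal, probReal_compl_eq_one_sub hs]
    exact ENNReal.ofReal_le_ofReal (by linarith)
  have hε : Integrable (fun y => y - g) (DI θ) := by
    have h := (hdiffuse.1 θ).1
    rwa [noiseLaw, integrable_map_measure (by fun_prop) (by fun_prop)] at h
  have hmean : ∫ y, (y - g) ∂(DI θ) = 0 := by
    have h := (hdiffuse.1 θ).2
    rwa [noiseLaw, integral_map (by fun_prop) (by fun_prop)] at h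
  have hi1 : Integrable ({y : EuclideanSpace ℝ (Fin d) | ‖y‖ ≤ τ}.indicator
      fun _ => ‖g‖ ^ 2) (DI θ) := (integrable_const _).indicator hs
  have hi2 : Integrable (fun y => inner ℝ g (y - g)) (DI θ) := hε.const_inner g
  have hi3 : Integrable ({y : EuclideanSpace ℝ (Fin d) | ‖y‖ ≤ τ}ᶜ.indicator
      fun y => ‖g‖ * ‖y - g‖) (DI θ) := (hε.norm.const_mul _).indicator hs.compl
  have hi : Integrable (fun y => f θ -
      β * ({y : EuclideanSpace ℝ (Fin d) | ‖y‖ ≤ τ}.indicator (fun _ => ‖g‖ ^ 2) y +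
        inner ℝ g (y - g) - {y : EuclideanSpace ℝ (Fin d) | ‖y‖ ≤ τ}ᶜ.indicator
          (fun y => ‖g‖ * ‖y - g‖) y) + L / 2 * β ^ 2 * τ ^ 2) (DI θ) :=
    ((integrable_const _).sub (((hi1.add hi2).sub hi3).const_mul β)).add (integrable_const _)
  have hpt : ∀ y, f (step DI β p θ y) ≤ f θ -
      β * ({y : EuclideanSpace ℝ (Fin d) | ‖y‖ ≤ τ}.indicator (fun _ => ‖g‖ ^ 2) y +
        inner ℝ g (y - g) - {y : EuclideanSpace ℝ (Fin d) | ‖y‖ ≤ τ}ᶜ.indicator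
          (fun y => ‖g‖ * ‖y - g‖) y) + L / 2 * β ^ 2 * τ ^ 2 := fun y => by
    refine (hf.step_le hL θ y hτ).trans ?_
    have := mul_le_mul_of_nonneg_left (le_clip_mul_inner hτ g y) hβ.le
    linarith
  have hpos : ∀ y, 0 ≤ f θ -
      β * ({y : EuclideanSpace ℝ (Fin d) | ‖y‖ ≤ τ}.indicator (fun _ => ‖g‖ ^ 2) y +
        inner ℝ g (y - g) - {y : EuclideanSpace ℝ (Fin d) | ‖y‖ ≤ τ}ᶜ.indicator
          (fun y => ‖g‖ * ‖y - g‖) y) + L / 2 * β ^ 2 * τ ^ 2 :=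
    fun y => (hf_nonneg _).trans (hpt y)
  have hle : ∫ y, (f θ -
      β * ({y : EuclideanSpace ℝ (Fin d) | ‖y‖ ≤ τ}.indicator (fun _ => ‖g‖ ^ 2) y +
        inner ℝ g (y - g) - {y : EuclideanSpace ℝ (Fin d) | ‖y‖ ≤ τ}ᶜ.indicator
          (fun y => ‖g‖ * ‖y - g‖) y) + L / 2 * β ^ 2 * τ ^ 2) ∂(DI θ) ≤
      f θ - β * (p * ‖g‖ ^ 2 - ‖g‖ * (B * η ^ (1 - 1 / q))) + L / 2 * β ^ 2 * τ ^ 2 := by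
    rw [integral_add (by fun_prop) (by fun_prop), integral_sub (by fun_prop) (by fun_prop),
      integral_const_mul, integral_sub (by fun_prop) (by fun_prop),
      integral_add (by fun_prop) (by fun_prop), integral_indicator hs,
      integral_indicator hs.compl, integral_const_mul, integral_inner hε, hmean]
    have hhold := setIntegral_le_of_moment (μ := DI θ) (X := fun y => ‖y - g‖) (by fun_prop)
      (fun _ => norm_nonneg _) hq hB (hm.moment_le θ) hη hsc
    simp only [integral_const, probReal_univ, inner_zero_right, add_zero, smul_eq_mul,
      measureReal_restrict_apply_univ, one_mul]
    gcongr
  -- Nonnegativity is inherited from `f`, which the integrand dominates at the new iterate.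
  refine ⟨(integral_nonneg hpos).trans hle,
    (lintegral_mono fun y => ENNReal.ofReal_le_ofReal (hpt y)).trans ?_⟩
  rw [← ofReal_integral_eq_lintegral_ofReal hi (ae_of_all _ hpos)]
  exact ENNReal.ofReal_le_ofReal hle

theorem drift_transitionKernel (hf_nonneg : ∀ θ, 0 ≤ f θ) (hL : 0 < L)
    (hf : LipschitzSmooth f L) (hη : 0 < η) (hη' : η < 1 / 2) (hdiffuse : UnbiasedDiffuse f DI)
    (hq : 1 < q) (hB : 0 < B) (hm : UniformMomentBound f DI q B) (hp : p = 1 - η) (hβ : 0 < β)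
    (hLβ : L * β ≤ η ^ 2) (hcond : L * β + η < 3 * p * (1 - η) / 4)
    (θ : EuclideanSpace ℝ (Fin d)) :
    ∫⁻ y, ENNReal.ofReal (f y) ∂(transitionKernel DI DO η β p θ) +
      ENNReal.ofReal (β * ((3 * p * (1 - η) / 4 - L * β - η) * ‖gradient f θ‖ ^ 2)) ≤
      ENNReal.ofReal (f θ) +
        ENNReal.ofReal (β * (5 * (B * η ^ (1 - 1 / q)) ^ 2 / (p * (1 - η)))) := by
  have hp₀ : 0 < p := by linarith
  have hτ₀ : 0 ≤ threshold DI p θ := quantile_nonneg hp₀ (map_norm_Iio_zero _)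
  have hτ : threshold DI p θ ≤ ‖gradient f θ‖ + B * η ^ (-(1 / q)) :=
    quantile_le hp₀ (map_norm_Iio_zero _) (hp ▸ hm.ofReal_le_measure hq hB hη θ)
  have hfm : Measurable fun y => ENNReal.ofReal (f y) :=
    (hf.1.continuous.measurable).ennreal_ofReal
  obtain ⟨hA, hin⟩ := lintegral_step_inlier_le hf_nonneg hL hf hη hη' hdiffuse hq hB hm hp hβ θ
  have hout := lintegral_step_outlier_le (DO := DO) hL hf hβ θ hτ₀
  have hsplit : ∫⁻ y, ENNReal.ofReal (f y) ∂(transitionKernel DI DO η β p θ) =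
      ENNReal.ofReal η * ∫⁻ y, ENNReal.ofReal (f (step DI β p θ y)) ∂(DO θ) +
      ENNReal.ofReal (1 - η) * ∫⁻ y, ENNReal.ofReal (f (step DI β p θ y)) ∂(DI θ) := by
    change ∫⁻ y, ENNReal.ofReal (f y) ∂((ENNReal.ofReal η • DO θ +
      ENNReal.ofReal (1 - η) • DI θ).map fun g => step DI β p θ g) = _
    rw [lintegral_map hfm (measurable_step_right DI β p θ),
      lintegral_add_measure, lintegral_smul_measure, lintegral_smul_measure]
    rfl
  -- Hölder's bound is η times the Markov level, so outliers and clipping bias have the same order.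
  have hb : B * η ^ (1 - 1 / q) = η * (B * η ^ (-(1 / q))) := by
    rw [sub_eq_add_neg, Real.rpow_add hη, Real.rpow_one]
    ring
  have harith := drift_arith hL hβ hη hη' hLβ (norm_nonneg (gradient f θ)) hb hτ₀ hτ
  have hκ : 0 ≤ 3 * p * (1 - η) / 4 - L * β - η := by linarith
  have h1η : 0 ≤ 1 - η := by linarith
  have hF := hf_nonneg θ
  set x := ‖gradient f θ‖
  set τ := threshold DI p θ
  set b := B * η ^ (1 - 1 / q)
  have hx : 0 ≤ x := norm_nonneg _
  rw [hsplit]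
  calc _ ≤ ENNReal.ofReal η * ENNReal.ofReal (f θ + β * (x * τ) + L / 2 * β ^ 2 * τ ^ 2) +
        ENNReal.ofReal (1 - η) * ENNReal.ofReal (f θ - β * (p * x ^ 2 - x * b) +
          L / 2 * β ^ 2 * τ ^ 2) +
        ENNReal.ofReal (β * ((3 * p * (1 - η) / 4 - L * β - η) * x ^ 2)) := by gcongr
    _ ≤ _ := by
      rw [← ENNReal.ofReal_mul hη.le, ← ENNReal.ofReal_mul h1η,
        ← ENNReal.ofReal_add (by positivity) (by positivity),
        ← ENNReal.ofReal_add (by positivity) (by positivity),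
        ← ENNReal.ofReal_add (by positivity) (by positivity)]
      refine ENNReal.ofReal_le_ofReal ?_
      rw [← hp] at harith ⊢
      have : η = 1 - p := by linarith
      rw [this] at harith ⊢
      linarith

end Descent

end QCSGD

/-! ### The stationary gradient bound. -/

theorem proposition7 {d : ℕ}
    (f : EuclideanSpace ℝ (Fin d) → ℝ)
    (DI DO : Kernel (EuclideanSpace ℝ (Fin d)) (EuclideanSpace ℝ (Fin d)))
    [IsMarkovKernel DI] [IsMarkovKernel DO]
    (L q B η β p : ℝ)
    (hf_nonneg : ∀ θ, 0 ≤ f θ)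
    (hL : 0 < L) (hf_smooth : QCSGD.LipschitzSmooth f L)
    (hη₀ : 0 ≤ η) (hη : η < 1 / 2)
    (hdiffuse : QCSGD.UnbiasedDiffuse f DI)
    (hq : 1 < q) (hB : 0 < B) (hmoment : QCSGD.UniformMomentBound f DI q B)
    (hp : p = 1 - η)
    (hβ₀ : 0 < β) (hβ : β ≤ η ^ 2 / L)
    (hcond : L * β + η < 3 * p * (1 - η) / 4)
    (hbounded : Bornology.IsBounded (QCSGD.lowGradientSet f L q B η β p))
    (π : Measure (EuclideanSpace ℝ (Fin d))) [IsProbabilityMeasure π]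
    (hπ : Kernel.Invariant (QCSGD.transitionKernel DI DO η β p) π) :
    Integrable (fun θ => ‖gradient f θ‖ ^ 2) π ∧
    ∫ θ, ‖gradient f θ‖ ^ 2 ∂π ≤
      5 * η ^ (2 - 2 / q) * B ^ 2 /
        (p * (1 - η) * (3 * p * (1 - η) / 4 - L * β - η)) ∧
    (η ≤ 1 / 10 →
      Real.sqrt (∫ θ, ‖gradient f θ‖ ^ 2 ∂π) ≤ 4 * B * η ^ (1 - 1 / q)) := by
  have hLβ : L * β ≤ η ^ 2 := by
    rw [le_div_iff₀ hL] at hβ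
    linarith
  -- The case η = 0 is excluded by 0 < Lβ ≤ η².
  have hηpos : 0 < η := by
    refine hη₀.lt_of_ne fun h => ?_
    have : 0 < L * β := by positivity
    rw [← h] at hLβ
    norm_num at hLβ
    linarith
  have hp₀ : 0 < p := by linarith
  have h1η : 0 < 1 - η := by linarith
  have hκ : 0 < 3 * p * (1 - η) / 4 - L * β - η := by linarith
  set κ := 3 * p * (1 - η) / 4 - L * β - η with hκ_def
  set b := B * η ^ (1 - 1 / q) with hb_def
  have hb₀ : 0 < b := by positivity
  have hb2 : 5 * η ^ (2 - 2 / q) * B ^ 2 / (p * (1 - η) * κ) =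
      5 * b ^ 2 / (p * (1 - η)) / κ := by
    rw [hb_def, mul_pow, ← Real.rpow_natCast (η ^ (1 - 1 / q)) 2, ← Real.rpow_mul hη₀,
      show (1 - 1 / q) * ((2 : ℕ) : ℝ) = 2 - 2 / q by push_cast; ring, div_div]
    ring
  have hgm : Measurable (gradient f) :=
    (InnerProductSpace.toDual ℝ _).symm.continuous.measurable.comp (measurable_fderiv ℝ f)
  have hK : ∀ θ, QCSGD.transitionKernel DI DO η β p θ univ ≤ 1 := fun θ => by
    change ((ENNReal.ofReal η • DO θ + ENNReal.ofReal (1 - η) • DI θ).map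
      fun g => QCSGD.step DI β p θ g) univ ≤ 1
    rw [Measure.map_apply (QCSGD.measurable_step_right DI β p θ)
      MeasurableSet.univ]
    simp [← ENNReal.ofReal_add hη₀ h1η.le]
  have hdrift := QCSGD.lintegral_le_of_drift hK hπ (V := fun θ => ENNReal.ofReal (f θ))
    (φ := fun θ => ENNReal.ofReal (β * (κ * ‖gradient f θ‖ ^ 2)))
    hf_smooth.1.continuous.measurable.ennreal_ofReal (fun _ => ENNReal.ofReal_ne_top)
    (by fun_prop)
    (QCSGD.drift_transitionKernel hf_nonneg hL hf_smooth hηpos hη hdiffuse hq hB hmoment hp hβ₀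
      hLβ hcond)
  have hint' : Integrable (fun θ => β * (κ * ‖gradient f θ‖ ^ 2)) π := by
    refine ⟨by fun_prop, ?_⟩
    rw [hasFiniteIntegral_iff_ofReal (ae_of_all _ fun θ => by positivity)]
    exact hdrift.trans_lt ENNReal.ofReal_lt_top
  have hint : Integrable (fun θ => ‖gradient f θ‖ ^ 2) π := by
    refine ((hint'.const_mul (β * κ)⁻¹).congr (ae_of_all _ fun θ => ?_))
    field_simp
  have hle : ∫ θ, ‖gradient f θ‖ ^ 2 ∂π ≤ 5 * b ^ 2 / (p * (1 - η)) / κ := by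
    rw [← ofReal_integral_eq_lintegral_ofReal hint' (ae_of_all _ fun θ => by positivity),
      ENNReal.ofReal_le_ofReal_iff (by positivity), integral_const_mul, integral_const_mul] at hdrift
    rw [le_div_iff₀ hκ, mul_comm]
    exact le_of_mul_le_mul_left hdrift hβ₀
  refine ⟨hint, hb2 ▸ hle, fun hη10 => ?_⟩
  -- Here 16 = 4². For η ≤ 1/10, p(1 - η) ≥ 0.81 and κ ≥ 0.6075 - 0.01 - 0.1 > 0.49, so the product
  -- exceeds 6.
  have h16 : 5 ≤ 16 * (p * (1 - η)) * κ := by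
    have hs : 81 / 100 ≤ p * (1 - η) := by rw [hp]; nlinarith
    have hκ' : 1 / 2 - 1 / 100 ≤ κ := by
      have : η ^ 2 ≤ 1 / 100 := by nlinarith
      rw [hκ_def]
      linarith
    nlinarith
  rw [mul_assoc, ← hb_def]
  refine Real.sqrt_le_iff.2 ⟨by positivity, hle.trans ?_⟩
  rw [div_div, div_le_iff₀ (by positivity)]
  have := mul_le_mul_of_nonneg_right h16 (sq_nonneg b)
  linarith
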